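/- Let $K$ be a field, let $G$ be a finite simple graph with vertex set $V=\{v_1,\dots,v_n\}$, let $S=K[X_1,\dots,X_n]$, let $I(G)\subseteq S$ be the edge ideal of $G$, generated by the monomials $X_iX_j$ with $v_i$ adjacent to $v_j$, and let $R=S/I(G)$ be the edge ring of $G$ with its standard grading. A graded $R$-module $M$ has a linear $R$-free resolution if there is an exact sequence $\cdots\to R^{b_2}\to R^{b_1}\to R^{b_0}\to M\to 0$ with finite $b_i$, in which the basis elements of $R^{b_0}$ are sent to homogeneous elements of $M$ of one common degree and all matrices representing the maps $R^{b_{i+1}}\to R^{b_i}$, $i\ge 0$, have entries that are homogeneous of degree $1$ (entries equal to $0$ are allowed). The ring $R$ is universally Koszul if for each ideal $J$ of $R$ generated by elements of degree $1$ (including $J=0$) the $R$-module $R/J$ has a linear $R$-free resolution. The graph $G$ is $(2K_2,P_4)$-free if it has no induced subgraph isomorphic to $2K_2$ (the disjoint union of two edges) or to $P_4$ (the path with four vertices and three edges). The following conditions are equivalent: 1. $R$ is universally Koszul; 2. $G$ is $(2K_2,P_4)$-free. -/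

import Mathlib

/-- The grading by degree of the standard graded algebra `K[X_v : v ∈ σ] / I`
(for a homogeneous ideal `I`): the degree `d` part consists of the residue classes of the
homogeneous polynomials of degree `d`. -/
noncomputable def stdGrading {K σ : Type*} [Field K] (I : Ideal (MvPolynomial σ K)) (d : ℕ) :
    Submodule K (MvPolynomial σ K ⧸ I) :=
  (MvPolynomial.homogeneousSubmodule σ K d).map (Ideal.Quotient.mkₐ K I).toLinearMap

/-- For a ring `R` with grading `𝒜` and an ideal `J` (generated by homogeneous elements),
the induced grading of `R ⧸ J`. -/
noncomputable def quotientGrading {K R : Type*} [Field K] [CommRing R] [Algebra K R]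
    (𝒜 : ℕ → Submodule K R) (J : Ideal R) (d : ℕ) : Submodule K (R ⧸ J) :=
  (𝒜 d).map (Ideal.Quotient.mkₐ K J).toLinearMap

/-- The matrices `A i` together with the augmentation `ε` form a linear graded free resolution
`⋯ → R ^ b 2 → R ^ b 1 → R ^ b 0 → M → 0` of the graded `R`-module `M`:
the basis of `R ^ b 0` is sent to homogeneous elements of one common degree, the augmented complex
is exact, and all entries of all matrices are homogeneous of degree `1` (zero is allowed).
Over a standard graded algebra over a field such entries lie in the homogeneous maximal ideal,
so that the resolution is automatically the minimal one. -/
structure IsLinearFreeResolution {K R M : Type*} [Field K] [CommRing R] [Algebra K R]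
    [AddCommGroup M] [Module R M] [Module K M] [IsScalarTower K R M]
    (𝒜 : ℕ → Submodule K R) (ℳ : ℕ → Submodule K M)
    (b : ℕ → ℕ) (A : ∀ i : ℕ, Matrix (Fin (b i)) (Fin (b (i + 1))) R)
    (ε : (Fin (b 0) → R) →ₗ[R] M) : Prop where
  linear : ∀ i j k, A i j k ∈ 𝒜 1
  homogeneous : ∃ d : ℕ, ∀ j, ε (Pi.single j 1) ∈ ℳ d
  surjective : Function.Surjective ε
  exact_zero : LinearMap.ker ε = LinearMap.range (A 0).mulVecLin
  exact_succ : ∀ i, LinearMap.ker (A i).mulVecLin = LinearMap.range (A (i + 1)).mulVecLin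

/-- The graded `R`-module `M` has a linear `R`-free resolution. -/
def HasLinearFreeResolution {K R M : Type*} [Field K] [CommRing R] [Algebra K R]
    [AddCommGroup M] [Module R M] [Module K M] [IsScalarTower K R M]
    (𝒜 : ℕ → Submodule K R) (ℳ : ℕ → Submodule K M) : Prop :=
  ∃ (b : ℕ → ℕ) (A : ∀ i : ℕ, Matrix (Fin (b i)) (Fin (b (i + 1))) R)
    (ε : (Fin (b 0) → R) →ₗ[R] M), IsLinearFreeResolution 𝒜 ℳ b A ε

/-- `R`, with grading `𝒜`, is universally Koszul: for every ideal `J` of `R` generated by elements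
of degree `1`, the `R`-module `R ⧸ J` has a linear `R`-free resolution. -/
def IsUniversallyKoszul {K R : Type*} [Field K] [CommRing R] [Algebra K R]
    (𝒜 : ℕ → Submodule K R) : Prop :=
  ∀ s : Set R, (∀ x ∈ s, x ∈ 𝒜 1) →
    HasLinearFreeResolution 𝒜 (quotientGrading 𝒜 (Ideal.span s))

/-- The edge ideal of `G`, generated by the monomials `X_u X_v` with `u` adjacent to `v`. -/
noncomputable def edgeIdeal (K : Type*) [Field K] {V : Type*} (G : SimpleGraph V) :
    Ideal (MvPolynomial V K) :=
  Ideal.span {p | ∃ u v : V, G.Adj u v ∧ p = MvPolynomial.X u * MvPolynomial.X v}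

attribute [local instance] MvPolynomial.gradedAlgebra in
/-- The edge ideal is homogeneous, so the edge ring is a standard graded algebra. -/
theorem edgeIdeal_isHomogeneous (K : Type*) [Field K] {V : Type*} (G : SimpleGraph V) :
    (edgeIdeal K G).IsHomogeneous (MvPolynomial.homogeneousSubmodule V K) := by
  apply Ideal.homogeneous_span
  rintro p ⟨u, v, -, rfl⟩
  exact ⟨2, (MvPolynomial.isHomogeneous_X K u).mul (MvPolynomial.isHomogeneous_X K v)⟩

/-- The edge ring `K[X_v : v ∈ V] / I(G)`. -/
abbrev EdgeRing (K : Type*) [Field K] {V : Type*} (G : SimpleGraph V) : Type _ :=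
  MvPolynomial V K ⧸ edgeIdeal K G

/-- The standard grading of the edge ring. -/
noncomputable def edgeRingGrading (K : Type*) [Field K] {V : Type*} (G : SimpleGraph V) :
    ℕ → Submodule K (EdgeRing K G) :=
  stdGrading (edgeIdeal K G)

/-- `2K₂`, the disjoint union of two complete graphs on two vertices. -/
def twoK2 : SimpleGraph (Fin 2 ⊕ Fin 2) :=
  (⊤ : SimpleGraph (Fin 2)) ⊕g (⊤ : SimpleGraph (Fin 2))

/-- `G` is `(2K₂, P₄)`-free: no induced subgraph is isomorphic to `2K₂` or to the path `P₄` on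
four vertices. -/
def IsTwoK2P4Free {V : Type*} (G : SimpleGraph V) : Prop :=
  ¬ twoK2.IsIndContained G ∧ ¬ (SimpleGraph.pathGraph 4).IsIndContained G

/-!
The condition on the graph is equivalent to the following one: any two nonadjacent vertices have
comparable neighbourhoods (`isTwoK2P4Free_iff_hasNestedNeighbors`).

Suppose that this holds. For a vertex `x` of minimal degree, every vertex not adjacent to `x` is
adjacent to all neighbours of `x`, so the graph is the join of the neighbourhood of `x` with a graph
in which `x` is isolated. On edge rings, a join gives a fibre product over `K`, and an isolated
vertex gives a polynomial ring in one variable. Both constructions preserve the property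
`HasLinearColons`: for an ideal `J` generated by linear forms and a linear form `ℓ` outside `J`, the
ideal `J : ℓ` is generated by linear forms (`HasLinearColons.fiberProduct`,
`HasLinearColons.polynomial`). By induction every edge ring of such a graph has this property.

Linear colon ideals yield linear resolutions. An ideal generated by linear forms has generators with
linear quotients, and the syzygies of vectors of linear forms with linear quotients are generated by
vectors of the same kind (`HasLinearColons.exists_syzygies_list`): projecting the syzygies of
`v, w₁, …, wₖ` to the first coordinate gives the linear ideal `(w₁, …, wₖ) : v`, and the kernel of
the projection is the syzygy module of `w₁, …, wₖ`. Iterating produces the resolution.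

Conversely, let `r`, `s` be nonadjacent, let `p` be adjacent to `r` but not to `s`, and `q` adjacent
to `s` but not to `r`. The product `X_r X_s` annihilates `ℓ = X_p - X_q`, while no linear form that
annihilates `ℓ` involves `X_r` or `X_s` (`edgeToPolynomial_eq_zero_of_mul_eq_zero`). So the
annihilator of `ℓ` is not generated by linear forms, whereas a linear resolution of `R / (ℓ)` would
force it to be (`IsDegreeHom.mem_span_of_mul_eq_zero`).

The grading enters only through the homomorphism `R → R[T]`, `X_v ↦ X_v T`, whose coefficients are
the homogeneous components (`IsDegreeHom`).
-/

/-! ### Linear colon ideals -/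

/-- For a set `s` of linear forms and a linear form `ℓ` outside the ideal `(s)`, the colon ideal
`(s) : ℓ` is generated by linear forms. Here `L` is the space of linear forms of `R`. -/
def HasLinearColons {K R : Type*} [Field K] [CommRing R] [Algebra K R] (L : Submodule K R) : Prop :=
  ∀ s : Set R, s ⊆ L → ∀ ℓ ∈ L, ℓ ∉ Ideal.span s → ∀ f : R, f * ℓ ∈ Ideal.span s →
    f ∈ Ideal.span {g | g ∈ L ∧ g * ℓ ∈ Ideal.span s}

theorem HasLinearColons.of_algEquiv {K R A : Type*} [Field K] [CommRing R] [Algebra K R]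
    [CommRing A] [Algebra K A] {L : Submodule K R} {LA : Submodule K A} (e : R ≃ₐ[K] A)
    (he : ∀ r, e r ∈ LA ↔ r ∈ L) (h : HasLinearColons LA) : HasLinearColons L := by
  have key : ∀ (t : Set R) (r : R), e r ∈ Ideal.span (e '' t) ↔ r ∈ Ideal.span t := by
    intro t r
    constructor
    · intro h
      have := Ideal.mem_map_of_mem (e.symm : A →+* R) h
      rw [Ideal.map_span] at this
      simpa [Set.image_image] using this
    · intro h
      have := Ideal.mem_map_of_mem (e : R →+* A) h
      rw [Ideal.map_span] at this
      simpa using this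
  intro s hs ℓ hℓ hℓs f hf
  rw [← key]
  have h1 := h (e '' s) (by rintro _ ⟨r, hr, rfl⟩; exact (he r).2 (hs hr)) (e ℓ) ((he ℓ).2 hℓ)
    (by rwa [key]) (e f) (by rwa [← map_mul, key])
  refine Ideal.span_mono ?_ h1
  rintro g ⟨hg, hg'⟩
  obtain ⟨r, rfl⟩ := e.surjective g
  exact ⟨r, ⟨(he r).1 hg, by rwa [← key, map_mul]⟩, rfl⟩

/-! ### Polynomial extensions -/

open Polynomial in
/-- The linear forms of a polynomial ring `A[X]`, where `LA` are the linear forms of `A`. -/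
noncomputable def polynomialLinearForms {K A : Type*} [Field K] [CommRing A] [Algebra K A]
    (LA : Submodule K A) : Submodule K A[X] :=
  LA.map (CAlgHom : A →ₐ[K] A[X]).toLinearMap ⊔ Submodule.span K {X}

section Poly
open Polynomial

variable {K A : Type*} [Field K] [CommRing A] [Algebra K A] {LA : Submodule K A}

theorem mem_polynomialLinearForms {p : A[X]} :
    p ∈ polynomialLinearForms LA ↔ ∃ a ∈ LA, ∃ c : K, p = C a + c • X := by
  simp only [polynomialLinearForms, Submodule.mem_sup, Submodule.mem_map,
    Submodule.mem_span_singleton]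
  constructor
  · rintro ⟨_, ⟨a, ha, rfl⟩, _, ⟨c, rfl⟩, rfl⟩
    exact ⟨a, ha, c, rfl⟩
  · rintro ⟨a, ha, c, rfl⟩
    exact ⟨_, ⟨a, ha, rfl⟩, _, ⟨c, rfl⟩, rfl⟩

theorem sub_C_eval_mem {I : Ideal A[X]} {z : A} (hz : X - C z ∈ I) (g : A[X]) :
    g - C (g.eval z) ∈ I :=
  I.mem_of_dvd X_sub_C_dvd_sub_C_eval hz

theorem eval_mem_linearForms {z : A} (hz : z ∈ LA) {p : A[X]}
    (hp : p ∈ polynomialLinearForms LA) : p.eval z ∈ LA := by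
  obtain ⟨a, ha, c, rfl⟩ := mem_polynomialLinearForms.1 hp
  simpa using LA.add_mem ha (LA.smul_mem c hz)

theorem C_add_smul_X_eq {a : A} {c : K} (hc : c ≠ 0) :
    C a + c • X = C (algebraMap K A c) * (X - C (-(c⁻¹ • a))) := by
  have : algebraMap K A c * algebraMap K A c⁻¹ = 1 := by rw [← map_mul, mul_inv_cancel₀ hc, map_one]
  rw [Algebra.smul_def, Algebra.smul_def, mul_sub, ← C_mul, mul_neg, ← mul_assoc, this,
    Polynomial.algebraMap_apply]
  simp [add_comm]

/-- If the ideal contains a linear form `X - z`, both the ideal and the colon ideal are determined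
by their images under the evaluation `X ↦ z`, so that the claim descends to `A`. -/
theorem HasLinearColons.polynomial_of_X_sub_C_mem (h : HasLinearColons LA) {s : Set A[X]}
    (hs : s ⊆ polynomialLinearForms LA) {ℓ : A[X]} (hℓ : ℓ ∈ polynomialLinearForms LA)
    (hℓs : ℓ ∉ Ideal.span s) {f : A[X]} (hf : f * ℓ ∈ Ideal.span s) {z : A} (hz : z ∈ LA)
    (hzs : X - C z ∈ Ideal.span s) :
    f ∈ Ideal.span {g | g ∈ polynomialLinearForms LA ∧ g * ℓ ∈ Ideal.span s} := by
  set s' : Set A := (evalRingHom z) '' s with hs'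
  have h1 : ∀ g ∈ Ideal.span s, g.eval z ∈ Ideal.span s' := by
    intro g hg
    rw [hs', ← Ideal.map_span]
    exact Ideal.mem_map_of_mem (evalRingHom z) hg
  have h2 : ∀ a ∈ Ideal.span s', C a ∈ Ideal.span s := by
    intro a ha
    have : Ideal.span s' ≤ (Ideal.span s).comap C := by
      rw [Ideal.span_le]
      rintro _ ⟨w, hw, rfl⟩
      have := Ideal.sub_mem _ (Ideal.subset_span hw) (sub_C_eval_mem hzs w)
      simpa using this
    exact this ha
  have h3 : ℓ.eval z ∉ Ideal.span s' := by
    intro hcon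
    have := Ideal.add_mem _ (sub_C_eval_mem hzs ℓ) (h2 _ hcon)
    exact hℓs (by simpa using this)
  have h4 := h s' (by rintro _ ⟨w, hw, rfl⟩; exact eval_mem_linearForms hz (hs hw)) _
    (eval_mem_linearForms hz hℓ) h3 (f.eval z) (by simpa using h1 _ hf)
  have h5 : f - C (f.eval z) ∈
      Ideal.span {g | g ∈ polynomialLinearForms LA ∧ g * ℓ ∈ Ideal.span s} := by
    have hX : X - C z ∈ polynomialLinearForms LA :=
      mem_polynomialLinearForms.2 ⟨-z, LA.neg_mem hz, 1, by rw [C_neg, one_smul]; ring⟩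
    exact sub_C_eval_mem (Ideal.subset_span (And.intro hX (Ideal.mul_mem_right _ _ hzs))) f
  have h6 : C (f.eval z) ∈
      Ideal.span {g | g ∈ polynomialLinearForms LA ∧ g * ℓ ∈ Ideal.span s} := by
    have := Ideal.mem_map_of_mem (C : A →+* A[X]) h4
    rw [Ideal.map_span] at this
    refine Ideal.span_mono ?_ this
    rintro _ ⟨g, ⟨hg, hg'⟩, rfl⟩
    refine ⟨mem_polynomialLinearForms.2 ⟨g, hg, 0, by simp⟩, ?_⟩
    have e : C g * ℓ = C g * (ℓ - C (ℓ.eval z)) + C (g * ℓ.eval z) := by rw [C_mul]; ring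
    rw [e]
    exact Ideal.add_mem _ (Ideal.mul_mem_left _ _ (sub_C_eval_mem hzs ℓ)) (h2 _ hg')
  simpa using Ideal.add_mem _ h5 h6

/-- Adjoining a free variable preserves linearity of colon ideals. -/
theorem HasLinearColons.polynomial (h : HasLinearColons LA) :
    HasLinearColons (polynomialLinearForms LA) := by
  intro s hs ℓ hℓ hℓs f hf
  by_cases hX : ∃ a ∈ LA, ∃ c : K, c ≠ 0 ∧ C a + c • X ∈ s
  · obtain ⟨a, ha, c, hc, hw⟩ := hX
    refine h.polynomial_of_X_sub_C_mem hs hℓ hℓs hf (z := -(c⁻¹ • a))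
      (LA.neg_mem (LA.smul_mem _ ha)) ?_
    have hw' := Ideal.subset_span hw
    rw [C_add_smul_X_eq hc] at hw'
    have := Ideal.mul_mem_left _ (C (algebraMap K A c⁻¹)) hw'
    rwa [← mul_assoc, ← C_mul, ← map_mul, inv_mul_cancel₀ hc, map_one, C_1, one_mul] at this
  · -- Now all elements of `s` are constant polynomials.
    push Not at hX
    set s' : Set A := {a | a ∈ LA ∧ C a ∈ s} with hs'
    have hss : s = C '' s' := by
      ext w
      constructor
      · intro hw
        obtain ⟨a, ha, c, rfl⟩ := mem_polynomialLinearForms.1 (hs hw)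
        have hc : c = 0 := by
          by_contra hc
          exact hX a ha c hc hw
        subst hc
        exact ⟨a, ⟨ha, by simpa using hw⟩, by simp⟩
      · rintro ⟨a, ha, rfl⟩
        exact ha.2
    have hspan : Ideal.span s = (Ideal.span s').map C := by rw [Ideal.map_span, ← hss]
    obtain ⟨a, ha, c, rfl⟩ := mem_polynomialLinearForms.1 hℓ
    by_cases hc : c = 0
    · subst hc
      rw [zero_smul, add_zero] at hℓ hℓs hf
      rw [zero_smul, add_zero]
      have ha' : a ∉ Ideal.span s' := fun hcon => hℓs (by
        rw [hspan]; exact Ideal.mem_map_of_mem _ hcon)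
      have hT : f ∈ (Ideal.span {g | g ∈ LA ∧ g * a ∈ Ideal.span s'}).map C := by
        rw [Ideal.mem_map_C_iff]
        intro n
        refine h s' (fun _ hx => hx.1) a ha ha' _ ?_
        rw [hspan, Ideal.mem_map_C_iff] at hf
        simpa using hf n
      rw [Ideal.map_span] at hT
      refine Ideal.span_mono ?_ hT
      rintro _ ⟨g, ⟨hg, hg'⟩, rfl⟩
      refine ⟨mem_polynomialLinearForms.2 ⟨g, hg, 0, by simp⟩, ?_⟩
      rw [hspan, ← C_mul]
      exact Ideal.mem_map_of_mem _ hg'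
    · -- The form `ℓ` is monic up to a unit, hence a nonzerodivisor modulo `s`.
      have hfs : f ∈ Ideal.span s := by
        have hmem : ∀ p : A[X], p ∈ Ideal.span s ↔ p.map (Ideal.Quotient.mk (Ideal.span s')) = 0 := by
          intro p
          rw [hspan, Ideal.mem_map_C_iff, Polynomial.ext_iff]
          simp [Ideal.Quotient.eq_zero_iff_mem]
        have hf' := Ideal.mul_mem_left _ (C (algebraMap K A c⁻¹)) hf
        rw [C_add_smul_X_eq hc, mul_left_comm, ← mul_assoc (C _) (C _), ← C_mul, ← map_mul,
          inv_mul_cancel₀ hc, map_one, C_1, one_mul, hmem, Polynomial.map_mul, Polynomial.map_sub,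
          map_X, map_C] at hf'
        rw [hmem]
        exact (monic_X_sub_C _).mul_left_eq_zero_iff.1 hf'
      refine Ideal.span_mono ?_ hfs
      exact fun w hw => ⟨hs hw, Ideal.mul_mem_right _ _ (Ideal.subset_span hw)⟩

end Poly

/-! ### Degrees and fibre products -/

section Fiber
open Polynomial

/-- An algebra homomorphism `φ : R → R[X]` that encodes a standard grading of `R` with space of
linear forms `L`: the coefficient of `X ^ n` in `φ r` is the component of `r` of degree `n`. Only
the components of degree `0` and `1` are needed. -/
structure IsDegreeHom {K R : Type*} [Field K] [CommRing R] [Algebra K R] (L : Submodule K R)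
    (φ : R →ₐ[K] R[X]) : Prop where
  map_linear : ∀ l ∈ L, φ l = C l * X
  coeff_zero : ∀ r, ∃ c : K, (φ r).coeff 0 = algebraMap K R c
  coeff_one : ∀ r, (φ r).coeff 1 ∈ L
  sub_coeff_zero_mem : ∀ r, r - (φ r).coeff 0 ∈ Ideal.span (L : Set R)

variable {K R A B : Type*} [Field K] [CommRing R] [Algebra K R] [CommRing A] [Algebra K A]
  [CommRing B] [Algebra K B] {L : Submodule K R} {LA : Submodule K A} {LB : Submodule K B}

theorem IsDegreeHom.coeff_succ_mul {φ : R →ₐ[K] R[X]} (hφ : IsDegreeHom L φ) {l : R} (hl : l ∈ L)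
    (r : R) (n : ℕ) : (φ (r * l)).coeff (n + 1) = (φ r).coeff n * l := by
  rw [map_mul, hφ.map_linear l hl, ← mul_assoc, coeff_mul_X, coeff_mul_C]

theorem IsDegreeHom.coeff_one_of_mem {φ : R →ₐ[K] R[X]} (hφ : IsDegreeHom L φ) {l : R}
    (hl : l ∈ L) : (φ l).coeff 1 = l := by
  simp [hφ.map_linear l hl]

theorem IsDegreeHom.coeff_one_mem_span {φ : R →ₐ[K] R[X]} (hφ : IsDegreeHom L φ) {s : Set R}
    (hs : s ⊆ L) {y : R} (hy : y ∈ Ideal.span s) : (φ y).coeff 1 ∈ Submodule.span K s := by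
  induction hy using Submodule.closure_induction with
  | zero => simp
  | add x y _ _ hx hy => simpa using Submodule.add_mem _ hx hy
  | smul_mem r x hx =>
    obtain ⟨c, hc⟩ := hφ.coeff_zero r
    rw [smul_eq_mul, hφ.coeff_succ_mul (hs hx), hc, ← Algebra.smul_def]
    exact Submodule.smul_mem _ _ (Submodule.subset_span hx)

theorem IsDegreeHom.coeff_two_mem_span {φ : R →ₐ[K] R[X]} (hφ : IsDegreeHom L φ) {s : Set R}
    (hs : s ⊆ L) {y : R} (hy : y ∈ Ideal.span s) :
    (φ y).coeff 2 ∈ Submodule.span K {x | ∃ l ∈ L, ∃ w ∈ s, x = l * w} := by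
  induction hy using Submodule.closure_induction with
  | zero => simp
  | add x y _ _ hx hy => simpa using Submodule.add_mem _ hx hy
  | smul_mem r x hx =>
    rw [smul_eq_mul, hφ.coeff_succ_mul (hs hx)]
    exact Submodule.subset_span ⟨_, hφ.coeff_one r, _, hx, rfl⟩

/-- If a linear form `ℓ` is not in the ideal generated by a set `s` of linear forms, then
`(s) : ℓ` is contained in the ideal generated by all linear forms. -/
theorem IsDegreeHom.mem_span_of_mul_mem {φ : R →ₐ[K] R[X]} (hφ : IsDegreeHom L φ) {s : Set R}
    (hs : s ⊆ L) {ℓ : R} (hℓ : ℓ ∈ L) (hℓs : ℓ ∉ Ideal.span s) {f : R}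
    (hf : f * ℓ ∈ Ideal.span s) : f ∈ Ideal.span (L : Set R) := by
  have h1 := hφ.coeff_one_mem_span hs hf
  rw [hφ.coeff_succ_mul hℓ] at h1
  obtain ⟨c, hc⟩ := hφ.coeff_zero f
  have hc0 : c = 0 := by
    by_contra hc0
    rw [hc, ← Algebra.smul_def] at h1
    have h2 := Submodule.smul_mem _ c⁻¹ h1
    rw [smul_smul, inv_mul_cancel₀ hc0, one_smul] at h2
    exact hℓs (Submodule.span_subset_span K R s h2)
  have := hφ.sub_coeff_zero_mem f
  simpa [hc, hc0] using this

/-- The graded algebra `A` is a retract of `R` along `i` and `π` such that multiplication by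
linear forms of `A` factors through `π`, as for the first factor of a fibre product
`R = A ×_K B`. -/
structure IsSplitFactor (L : Submodule K R) (LA : Submodule K A) (i : A →ₐ[K] R)
    (π : R →ₐ[K] A) : Prop where
  map_mem : ∀ l ∈ LA, i l ∈ L
  proj_mem : ∀ l ∈ L, π l ∈ LA
  mul_map : ∀ r, ∀ l ∈ LA, r * i l = i (π r * l)

theorem IsSplitFactor.map_proj_mem {i : A →ₐ[K] R} {π : R →ₐ[K] A}
    (h : IsSplitFactor L LA i π) (hA : HasLinearColons LA) {φ : A →ₐ[K] A[X]}
    (hφ : IsDegreeHom LA φ) {s : Set R} (hs : s ⊆ L) {ℓ : R} (hℓ : ℓ ∈ L) {f : R}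
    (hfL : f ∈ Ideal.span (L : Set R)) (hf : f * ℓ ∈ Ideal.span s) :
    i (π f) ∈ Ideal.span {g | g ∈ L ∧ g * ℓ ∈ Ideal.span s} := by
  have hπ : ∀ (t : Set R), ∀ g ∈ Ideal.span t, π g ∈ Ideal.span (π '' t) := by
    intro t g hg
    have := Ideal.mem_map_of_mem (π : R →+* A) hg
    rwa [Ideal.map_span] at this
  have hs' : π '' s ⊆ LA := by
    rintro _ ⟨w, hw, rfl⟩
    exact h.proj_mem w (hs hw)
  -- It suffices to find `π f` in the ideal of `A` generated by the forms `g` with `i g ∈ (s) : ℓ`.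
  suffices hT : π f ∈ Ideal.span {g | g ∈ LA ∧ i (g * π ℓ) ∈ Ideal.span s} by
    have := Ideal.mem_map_of_mem (i : A →+* R) hT
    rw [Ideal.map_span] at this
    refine Ideal.span_mono ?_ this
    rintro _ ⟨g, ⟨hg, hg'⟩, rfl⟩
    refine ⟨h.map_mem g hg, ?_⟩
    have e : i g * ℓ = i (g * π ℓ) := by rw [mul_comm, h.mul_map _ _ hg, mul_comm]
    exact e ▸ hg'
  have hlin : ∀ l ∈ LA, ∀ w ∈ s, i (l * π w) ∈ Ideal.span s := by
    intro l hl w hw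
    rw [mul_comm, ← h.mul_map _ _ hl]
    exact Ideal.mul_mem_right _ _ (Ideal.subset_span hw)
  -- In degree two, the ideal `(π s)` is mapped into `(s)`.
  have hdeg : ∀ g ∈ LA, ∀ a ∈ LA, g * a ∈ Ideal.span (π '' s) → i (g * a) ∈ Ideal.span s := by
    intro g hg a ha hga
    have h2 := hφ.coeff_two_mem_span hs' hga
    rw [hφ.coeff_succ_mul ha, hφ.coeff_one_of_mem hg] at h2
    have hle : Submodule.span K {x | ∃ l ∈ LA, ∃ w ∈ π '' s, x = l * w} ≤
        ((Ideal.span s).restrictScalars K).comap i.toLinearMap := by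
      rw [Submodule.span_le]
      rintro _ ⟨l, hl, _, ⟨w, hw, rfl⟩, rfl⟩
      exact hlin l hl w hw
    exact hle h2
  by_cases ha : π ℓ ∈ Ideal.span (π '' s)
  · have hfA : π f ∈ Ideal.span (LA : Set A) := by
      refine Ideal.span_mono ?_ (hπ _ f hfL)
      rintro _ ⟨l, hl, rfl⟩
      exact h.proj_mem l hl
    refine Ideal.span_mono ?_ hfA
    exact fun g hg => ⟨hg, hdeg g hg _ (h.proj_mem ℓ hℓ) (Ideal.mul_mem_left _ _ ha)⟩
  · have := hA (π '' s) hs' (π ℓ) (h.proj_mem ℓ hℓ) ha (π f) (by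
      rw [← map_mul]; exact hπ _ _ hf)
    refine Ideal.span_mono ?_ this
    exact fun g hg => ⟨hg.1, hdeg g hg.1 _ (h.proj_mem ℓ hℓ) hg.2⟩

/-- Linearity of colon ideals passes to fibre products over the ground field. -/
theorem HasLinearColons.fiberProduct {iA : A →ₐ[K] R} {πA : R →ₐ[K] A} {iB : B →ₐ[K] R}
    {πB : R →ₐ[K] B} (hA : IsSplitFactor L LA iA πA) (hB : IsSplitFactor L LB iB πB)
    (hsum : ∀ l ∈ L, l = iA (πA l) + iB (πB l)) (hLA : HasLinearColons LA)
    (hLB : HasLinearColons LB) {φ : R →ₐ[K] R[X]} (hφ : IsDegreeHom L φ) {φA : A →ₐ[K] A[X]}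
    (hφA : IsDegreeHom LA φA) {φB : B →ₐ[K] B[X]} (hφB : IsDegreeHom LB φB) :
    HasLinearColons L := by
  intro s hs ℓ hℓ hℓs f hf
  have hfL := hφ.mem_span_of_mul_mem hs hℓ hℓs hf
  have hdecomp : f = iA (πA f) + iB (πB f) := by
    clear hf
    induction hfL using Submodule.closure_induction with
    | zero => simp
    | add x y _ _ hx hy =>
      nth_rw 1 [hx, hy]
      simp only [map_add]
      ring
    | smul_mem r l hl =>
      rw [smul_eq_mul]
      nth_rw 1 [hsum l hl]
      rw [mul_add, hA.mul_map _ _ (hA.proj_mem l hl),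
        hB.mul_map _ _ (hB.proj_mem l hl), ← map_mul, ← map_mul]
  rw [hdecomp]
  exact Ideal.add_mem _ (hA.map_proj_mem hLA hφA hs hℓ hfL hf)
    (hB.map_proj_mem hLB hφB hs hℓ hfL hf)

end Fiber

/-! ### Edge rings -/

section EdgeRing
open Polynomial

variable {K : Type*} [Field K] {V : Type*} {G : SimpleGraph V}

/-- The residue class of the variable `X_v` in the edge ring. -/
noncomputable def edgeVar (K : Type*) [Field K] {V : Type*} (G : SimpleGraph V) (v : V) :
    EdgeRing K G :=
  Ideal.Quotient.mk _ (MvPolynomial.X v)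

/-- The space of linear forms of the edge ring. -/
noncomputable def edgeLinearForms (K : Type*) [Field K] {V : Type*} (G : SimpleGraph V) :
    Submodule K (EdgeRing K G) :=
  Submodule.span K (Set.range (edgeVar K G))

theorem edgeVar_mem (v : V) : edgeVar K G v ∈ edgeLinearForms K G :=
  Submodule.subset_span ⟨v, rfl⟩

theorem edgeRingGrading_one : edgeRingGrading K G 1 = edgeLinearForms K G := by
  rw [edgeRingGrading, stdGrading, MvPolynomial.homogeneousSubmodule_one_eq_span_X,
    Submodule.map_span, edgeLinearForms, ← Set.range_comp]
  rfl

theorem edgeVar_mul_edgeVar {u v : V} (h : G.Adj u v) : edgeVar K G u * edgeVar K G v = 0 := by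
  rw [edgeVar, edgeVar, ← map_mul, Ideal.Quotient.eq_zero_iff_mem]
  exact Ideal.subset_span ⟨u, v, h, rfl⟩

/-- The universal property of the edge ring. -/
noncomputable def edgeLift {A : Type*} [CommRing A] [Algebra K A] (f : V → A)
    (hf : ∀ u v, G.Adj u v → f u * f v = 0) : EdgeRing K G →ₐ[K] A :=
  Ideal.Quotient.liftₐ (edgeIdeal K G) (MvPolynomial.aeval f) (by
    suffices h : edgeIdeal K G ≤ RingHom.ker (MvPolynomial.aeval f : MvPolynomial V K →ₐ[K] A) from
      fun a ha => h ha
    rw [edgeIdeal, Ideal.span_le]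
    rintro _ ⟨u, v, h, rfl⟩
    simp [RingHom.mem_ker, hf u v h])

@[simp]
theorem edgeLift_edgeVar {A : Type*} [CommRing A] [Algebra K A] (f : V → A)
    (hf : ∀ u v, G.Adj u v → f u * f v = 0) (v : V) : edgeLift f hf (edgeVar K G v) = f v :=
  MvPolynomial.aeval_X f v

theorem edgeRing_algHom_ext {A : Type*} [CommRing A] [Algebra K A] {f g : EdgeRing K G →ₐ[K] A}
    (h : ∀ v, f (edgeVar K G v) = g (edgeVar K G v)) : f = g :=
  Ideal.Quotient.algHom_ext _ (MvPolynomial.algHom_ext h)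

@[elab_as_elim]
theorem edgeRing_induction {P : EdgeRing K G → Prop} (const : ∀ c : K, P (algebraMap K _ c))
    (add : ∀ a b, P a → P b → P (a + b)) (mul : ∀ a v, P a → P (a * edgeVar K G v))
    (r : EdgeRing K G) : P r := by
  obtain ⟨p, rfl⟩ := Ideal.Quotient.mk_surjective r
  induction p using MvPolynomial.induction_on with
  | C c => exact const c
  | add p q hp hq => rw [map_add]; exact add _ _ hp hq
  | mul_X p v hp => rw [map_mul]; exact mul _ v hp

/-- The homomorphism `X_v ↦ X_v T`, which encodes the standard grading of the edge ring. -/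
noncomputable def edgeDegreeHom (K : Type*) [Field K] {V : Type*} (G : SimpleGraph V) :
    EdgeRing K G →ₐ[K] (EdgeRing K G)[X] :=
  edgeLift (fun v => C (edgeVar K G v) * X) (fun u v h => by
    have h' := congrArg C (edgeVar_mul_edgeVar (K := K) h)
    rw [C_mul, C_0] at h'
    linear_combination X ^ 2 * h')

theorem isDegreeHom_edgeDegreeHom : IsDegreeHom (edgeLinearForms K G) (edgeDegreeHom K G) := by
  have hX : ∀ v, edgeDegreeHom K G (edgeVar K G v) = C (edgeVar K G v) * X :=
    fun v => edgeLift_edgeVar _ _ v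
  have h0 : ∀ r : EdgeRing K G,
      ∃ c : K, (edgeDegreeHom K G r).coeff 0 = algebraMap K (EdgeRing K G) c := by
    intro r
    induction r using edgeRing_induction with
    | const c => exact ⟨c, by rw [AlgHom.commutes, Polynomial.algebraMap_apply, coeff_C_zero]⟩
    | add a b ha hb =>
      obtain ⟨c, hc⟩ := ha
      obtain ⟨d, hd⟩ := hb
      exact ⟨c + d, by rw [map_add, coeff_add, hc, hd, map_add]⟩
    | mul a v ha => exact ⟨0, by rw [map_mul, hX, ← mul_assoc, coeff_mul_X_zero, map_zero]⟩
  refine ⟨fun l hl => ?_, h0, fun r => ?_, fun r => ?_⟩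
  · induction hl using Submodule.span_induction with
    | mem x hx =>
      obtain ⟨v, rfl⟩ := hx
      exact hX v
    | zero => simp
    | add x y _ _ hx hy => rw [map_add, hx, hy, C_add, add_mul]
    | smul c x _ hx => rw [map_smul, hx, ← smul_C, smul_mul_assoc]
  · induction r using edgeRing_induction with
    | const c =>
      rw [AlgHom.commutes, Polynomial.algebraMap_apply, coeff_C_succ]
      exact Submodule.zero_mem _
    | add a b ha hb =>
      rw [map_add, coeff_add]
      exact Submodule.add_mem _ ha hb
    | mul a v ha =>
      obtain ⟨c, hc⟩ := h0 a
      rw [map_mul, hX, ← mul_assoc, coeff_mul_X, coeff_mul_C, hc, ← Algebra.smul_def]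
      exact Submodule.smul_mem _ _ (edgeVar_mem v)
  · induction r using edgeRing_induction with
    | const c =>
      rw [AlgHom.commutes, Polynomial.algebraMap_apply, coeff_C_zero, sub_self]
      exact Submodule.zero_mem _
    | add a b ha hb =>
      rw [map_add, coeff_add, add_sub_add_comm]
      exact Submodule.add_mem _ ha hb
    | mul a v ha =>
      rw [map_mul, hX, ← mul_assoc, coeff_mul_X_zero, sub_zero]
      exact Ideal.mul_mem_left _ _ (Ideal.subset_span (edgeVar_mem v))

theorem map_mem_of_mem_edgeLinearForms {A : Type*} [CommRing A] [Algebra K A]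
    {f : EdgeRing K G →ₐ[K] A} {N : Submodule K A} (h : ∀ v, f (edgeVar K G v) ∈ N)
    {l : EdgeRing K G} (hl : l ∈ edgeLinearForms K G) : f l ∈ N := by
  have : edgeLinearForms K G ≤ N.comap f.toLinearMap := by
    rw [edgeLinearForms, Submodule.span_le]
    rintro _ ⟨v, rfl⟩
    exact h v
  exact this hl

/-! ### Induced subgraphs -/

/-- The inclusion of the edge ring of an induced subgraph. -/
noncomputable def edgeExtend (K : Type*) [Field K] {V : Type*} (G : SimpleGraph V) (U : Set V) :
    EdgeRing K (G.induce U) →ₐ[K] EdgeRing K G :=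
  edgeLift (fun u => edgeVar K G u) (fun _ _ h => edgeVar_mul_edgeVar h)

open Classical in
/-- The retraction onto the edge ring of an induced subgraph, setting the variables outside `U`
to zero. -/
noncomputable def edgeRestrict (K : Type*) [Field K] {V : Type*} (G : SimpleGraph V) (U : Set V) :
    EdgeRing K G →ₐ[K] EdgeRing K (G.induce U) :=
  edgeLift (fun v => if h : v ∈ U then edgeVar K (G.induce U) ⟨v, h⟩ else 0) (fun u v h => by
    by_cases hu : u ∈ U
    · by_cases hv : v ∈ U
      · simp only [hu, hv, dite_true]
        exact edgeVar_mul_edgeVar h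
      · simp [hv]
    · simp [hu])

theorem edgeRestrict_of_mem {U : Set V} {v : V} (h : v ∈ U) :
    edgeRestrict K G U (edgeVar K G v) = edgeVar K (G.induce U) ⟨v, h⟩ := by
  simp [edgeRestrict, h]

theorem edgeRestrict_of_notMem {U : Set V} {v : V} (h : v ∉ U) :
    edgeRestrict K G U (edgeVar K G v) = 0 := by
  simp [edgeRestrict, h]

@[simp]
theorem edgeExtend_edgeVar {U : Set V} (u : U) :
    edgeExtend K G U (edgeVar K (G.induce U) u) = edgeVar K G u :=
  edgeLift_edgeVar _ _ u

/-- If all vertices of `U` are adjacent to all other vertices, the edge ring of the subgraph induced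
on `U` splits off. -/
theorem isSplitFactor_edgeRing {U : Set V} (hU : ∀ u ∈ U, ∀ w ∉ U, G.Adj u w) :
    IsSplitFactor (edgeLinearForms K G) (edgeLinearForms K (G.induce U)) (edgeExtend K G U)
      (edgeRestrict K G U) := by
  refine ⟨fun l hl => map_mem_of_mem_edgeLinearForms (fun v => ?_) hl,
    fun l hl => map_mem_of_mem_edgeLinearForms (fun v => ?_) hl, fun r l hl => ?_⟩
  · rw [edgeExtend_edgeVar]
    exact edgeVar_mem _
  · by_cases h : v ∈ U
    · rw [edgeRestrict_of_mem h]
      exact edgeVar_mem _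
    · rw [edgeRestrict_of_notMem h]
      exact Submodule.zero_mem _
  · induction hl using Submodule.span_induction with
    | mem l hl =>
      obtain ⟨u, rfl⟩ := hl
      induction r using edgeRing_induction with
      | const c => simp
      | add a b ha hb => simp only [add_mul, map_add, ha, hb]
      | mul a v ha =>
        rw [mul_right_comm, ha, map_mul (edgeRestrict K G U),
          mul_right_comm (edgeRestrict K G U a), map_mul (edgeExtend K G U) (_ * _)]
        by_cases hv : v ∈ U
        · rw [edgeRestrict_of_mem hv, edgeExtend_edgeVar]
        · rw [edgeRestrict_of_notMem hv, map_zero, mul_zero, map_mul, edgeExtend_edgeVar,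
            mul_assoc, edgeVar_mul_edgeVar (hU u u.2 v hv), mul_zero]
    | zero => simp
    | add x y _ _ hx hy => simp only [mul_add, map_add, hx, hy]
    | smul c x _ hx => rw [map_smul, mul_smul_comm, hx, mul_smul_comm, map_smul]

/-- The edge ring of a join of two graphs is the fibre product of their edge rings. -/
theorem hasLinearColons_of_join {U : Set V} (hU : ∀ u ∈ U, ∀ w ∉ U, G.Adj u w)
    (h1 : HasLinearColons (edgeLinearForms K (G.induce U)))
    (h2 : HasLinearColons (edgeLinearForms K (G.induce Uᶜ))) :
    HasLinearColons (edgeLinearForms K G) := by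
  refine HasLinearColons.fiberProduct (isSplitFactor_edgeRing hU)
    (isSplitFactor_edgeRing (U := Uᶜ) fun u hu w hw => (hU w (by simpa using hw) u hu).symm)
    (fun l hl => ?_) h1 h2 isDegreeHom_edgeDegreeHom isDegreeHom_edgeDegreeHom
    isDegreeHom_edgeDegreeHom
  induction hl using Submodule.span_induction with
  | mem l hl =>
    obtain ⟨v, rfl⟩ := hl
    by_cases hv : v ∈ U
    · rw [edgeRestrict_of_mem hv, edgeRestrict_of_notMem (U := Uᶜ) (by simpa using hv),
        edgeExtend_edgeVar, map_zero, add_zero]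
    · rw [edgeRestrict_of_mem (U := Uᶜ) hv, edgeRestrict_of_notMem hv, edgeExtend_edgeVar,
        map_zero, zero_add]
  | zero => simp
  | add x y _ _ hx hy =>
    nth_rw 1 [hx, hy]
    simp only [map_add]
    ring
  | smul c x _ hx =>
    nth_rw 1 [hx]
    simp only [map_smul, smul_add]

/-- The edge ring of a graph with an isolated vertex is a polynomial ring in one variable over the
edge ring of the remaining graph. -/
theorem hasLinearColons_of_isolated {x : V} (hx : ∀ v, ¬ G.Adj x v)
    (h : HasLinearColons (edgeLinearForms K (G.induce {x}ᶜ))) :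
    HasLinearColons (edgeLinearForms K G) := by
  classical
  set U : Set V := {x}ᶜ with hU
  let f : EdgeRing K G →ₐ[K] (EdgeRing K (G.induce U))[X] :=
    edgeLift (fun v => if h : v ∈ U then C (edgeVar K (G.induce U) ⟨v, h⟩) else X) (fun u v h => by
      have hu : u ∈ U := fun hu => hx v (by rw [Set.mem_singleton_iff] at hu; exact hu ▸ h)
      have hv : v ∈ U := fun hv => hx u (by rw [Set.mem_singleton_iff] at hv; exact hv ▸ h.symm)
      simp only [hu, hv, dite_true]
      rw [← C_mul, edgeVar_mul_edgeVar (by exact h), C_0])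
  have hfx : f (edgeVar K G x) = X := by simp [f, hU]
  have hf : ∀ v : U, f (edgeVar K G v) = C (edgeVar K (G.induce U) v) := fun v => by simp [f]
  let g : (EdgeRing K (G.induce U))[X] →ₐ[K] EdgeRing K G :=
    Polynomial.eval₂AlgHom (edgeExtend K G U) (edgeVar K G x) (fun _ => mul_comm _ _)
  have hgC : ∀ a, g (C a) = edgeExtend K G U a := fun a => Polynomial.eval₂_C _ _
  have hgX : g X = edgeVar K G x := Polynomial.eval₂_X _ _
  have hfg : f.comp g = AlgHom.id K _ := by
    refine Polynomial.algHom_ext'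
      (edgeRing_algHom_ext (A := (EdgeRing K (G.induce U))[X]) fun v => ?_) ?_
    · simp [hgC, hf]
    · simp [hgX, hfx]
  have hgf : g.comp f = AlgHom.id K _ := by
    refine edgeRing_algHom_ext fun v => ?_
    by_cases hv : v ∈ U
    · have := hf ⟨v, hv⟩
      simp only at this
      simp [this, hgC]
    · have : v = x := by simpa [hU] using hv
      subst this
      simp [hfx, hgX]
  let e : EdgeRing K G ≃ₐ[K] (EdgeRing K (G.induce U))[X] := AlgEquiv.ofAlgHom f g hfg hgf
  refine h.polynomial.of_algEquiv e fun r => ⟨fun hr => ?_, fun hr => ?_⟩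
  · obtain ⟨a, ha, c, hac⟩ := mem_polynomialLinearForms.1 hr
    have hr' : r = g (C a + c • X) := by
      rw [← hac]
      exact (e.symm_apply_apply r).symm
    rw [hr', map_add, map_smul, hgC, hgX]
    refine Submodule.add_mem _ (map_mem_of_mem_edgeLinearForms (fun v => ?_) ha)
      (Submodule.smul_mem _ _ (edgeVar_mem x))
    rw [edgeExtend_edgeVar]
    exact edgeVar_mem _
  · change f r ∈ _
    refine map_mem_of_mem_edgeLinearForms (fun v => ?_) hr
    by_cases hv : v ∈ U
    · have := hf ⟨v, hv⟩
      simp only at this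
      rw [this]
      exact mem_polynomialLinearForms.2 ⟨_, edgeVar_mem ⟨v, hv⟩, 0, by simp⟩
    · have : v = x := by simpa [hU] using hv
      subst this
      rw [hfx]
      exact mem_polynomialLinearForms.2 ⟨0, Submodule.zero_mem _, 1, by simp⟩

/-! ### Graphs with nested neighbourhoods -/

/-- Any two nonadjacent vertices have comparable neighbourhoods. -/
def HasNestedNeighbors (G : SimpleGraph V) : Prop :=
  ∀ r s, ¬ G.Adj r s → G.neighborSet r ⊆ G.neighborSet s ∨ G.neighborSet s ⊆ G.neighborSet r

theorem HasNestedNeighbors.induce (h : HasNestedNeighbors G) (U : Set V) :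
    HasNestedNeighbors (G.induce U) := by
  intro r s hrs
  exact (h r s hrs).imp (fun h' w hw => h' hw) (fun h' w hw => h' hw)

/-- A graph with nested neighbourhoods is a join of the neighbourhood of a vertex `x` of minimal
degree with a graph in which `x` is isolated. This reduces to smaller graphs. -/
theorem HasNestedNeighbors.hasLinearColons {V : Type*} [Finite V] {G : SimpleGraph V}
    (h : HasNestedNeighbors G) : HasLinearColons (edgeLinearForms K G) := by
  induction hn : Nat.card V using Nat.strong_induction_on generalizing V with
  | _ n ih =>
  subst hn
  cases isEmpty_or_nonempty V with
  | inl hV =>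
    intro s hs ℓ hℓ hℓs
    have : ℓ = 0 := by simpa [edgeLinearForms, Set.range_eq_empty] using hℓ
    exact absurd (this ▸ Ideal.zero_mem _) hℓs
  | inr hV =>
    obtain ⟨x, hx⟩ := Finite.exists_min fun v => (G.neighborSet v).ncard
    have hmin : ∀ y, ¬ G.Adj x y → G.neighborSet x ⊆ G.neighborSet y := by
      intro y hxy
      rcases h x y hxy with h' | h'
      · exact h'
      · exact (Set.eq_of_subset_of_ncard_le h' (hx y) (Set.toFinite _)).ge
    have hcard : ∀ U : Set V, x ∉ U → Nat.card U < Nat.card V := by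
      intro U hU
      rw [Nat.card_coe_set_eq, ← Set.ncard_univ]
      exact Set.ncard_lt_ncard (Set.ssubset_univ_iff.2 fun hc => hU (hc ▸ Set.mem_univ x))
        (Set.toFinite _)
    refine hasLinearColons_of_join (U := G.neighborSet x) (fun u hu w hw => (hmin w hw hu).symm)
      (ih _ (hcard _ (by simp)) (h.induce _) rfl) ?_
    refine hasLinearColons_of_isolated (x := ⟨x, by simp⟩) (fun v hv => v.2 hv)
      (ih _ ?_ ((h.induce _).induce _) rfl)
    refine lt_of_lt_of_le (b := Nat.card ↥(G.neighborSet x)ᶜ) ?_ (Finite.card_subtype_le _)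
    rw [Nat.card_coe_set_eq, ← Set.ncard_univ]
    exact Set.ncard_lt_ncard (Set.ssubset_univ_iff.2 fun hc => by
      have := hc.ge (Set.mem_univ (⟨x, by simp⟩ : ↥(G.neighborSet x)ᶜ))
      simp at this) (Set.toFinite _)

/-- Nonadjacent vertices `r` and `s` with incomparable neighbourhoods, together with neighbours `p`
of `r` and `q` of `s` that witness this, span an induced `P₄` or `2K₂`, according to whether `p` and
`q` are adjacent. Conversely, the end vertices of a `P₄`, or one vertex of each edge of a `2K₂`,
have incomparable neighbourhoods. -/
theorem isTwoK2P4Free_iff_hasNestedNeighbors :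
    IsTwoK2P4Free G ↔ HasNestedNeighbors G := by
  constructor
  · rintro ⟨h1, h2⟩ r s hrs
    by_contra hcon
    push Not at hcon
    obtain ⟨⟨p, hp, hp'⟩, ⟨q, hq, hq'⟩⟩ :=
      And.intro (Set.not_subset.1 hcon.1) (Set.not_subset.1 hcon.2)
    simp only [SimpleGraph.mem_neighborSet] at hp hp' hq hq'
    have hpr := G.adj_symm hp
    have hqs := G.adj_symm hq
    have hsr : ¬ G.Adj s r := fun h => hrs h.symm
    have hps : ¬ G.Adj p s := fun h => hp' h.symm
    have hqr : ¬ G.Adj q r := fun h => hq' h.symm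
    have n1 := hp.ne
    have n2 := hq.ne
    have n3 : r ≠ s := by rintro rfl; exact hp' hp
    have n4 : p ≠ q := by rintro rfl; exact hp' hq
    have n5 : p ≠ s := by rintro rfl; exact hrs hp
    have n6 : q ≠ r := by rintro rfl; exact hsr hq
    by_cases hpq : G.Adj p q
    · have hqp := hpq.symm
      refine h2 ⟨⟨⟨![r, p, q, s], ?_⟩, ?_⟩⟩
      · intro a b
        fin_cases a <;> fin_cases b <;> simp [n1, n2, n3, n4, n5, n6, n1.symm, n2.symm, n3.symm,
          n4.symm, n5.symm, n6.symm]
      · intro a b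
        change G.Adj (![r, p, q, s] a) (![r, p, q, s] b) ↔ _
        fin_cases a <;> fin_cases b <;> simp [SimpleGraph.pathGraph_adj, *]
    · have hqp : ¬ G.Adj q p := fun h => hpq h.symm
      refine h1 ⟨⟨⟨Sum.elim ![p, r] ![q, s], ?_⟩, ?_⟩⟩
      · rintro (a | a) (b | b) <;> fin_cases a <;> fin_cases b <;> simp [n1, n2, n3, n4, n5, n6,
          n1.symm, n2.symm, n3.symm, n4.symm, n5.symm, n6.symm]
      · intro a b
        change G.Adj (Sum.elim ![p, r] ![q, s] a) (Sum.elim ![p, r] ![q, s] b) ↔ _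
        rcases a with a | a <;> rcases b with b | b <;> fin_cases a <;> fin_cases b <;>
          simp [twoK2, *]
  · intro h
    constructor
    · rintro ⟨f⟩
      have hf : ∀ a b, G.Adj (f a) (f b) ↔ twoK2.Adj a b := fun a b => f.map_rel_iff
      have hrs : ¬ G.Adj (f (.inl 1)) (f (.inr 1)) := fun hc => by simpa [twoK2] using (hf _ _).1 hc
      rcases h _ _ hrs with h' | h'
      · have := h' ((hf (.inl 1) (.inl 0)).2 (by simp [twoK2]))
        simpa [twoK2] using (hf _ _).1 this
      · have := h' ((hf (.inr 1) (.inr 0)).2 (by simp [twoK2]))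
        simpa [twoK2] using (hf _ _).1 this
    · rintro ⟨f⟩
      have hf : ∀ a b, G.Adj (f a) (f b) ↔ (SimpleGraph.pathGraph 4).Adj a b :=
        fun a b => f.map_rel_iff
      have hrs : ¬ G.Adj (f 0) (f 3) := by simp [hf, SimpleGraph.pathGraph_adj]
      rcases h _ _ hrs with h' | h'
      · have := h' (a := f 1) (by simp [hf, SimpleGraph.pathGraph_adj])
        simp [hf, SimpleGraph.pathGraph_adj] at this
      · have := h' (a := f 2) (by simp [hf, SimpleGraph.pathGraph_adj])
        simp [hf, SimpleGraph.pathGraph_adj] at this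

end EdgeRing

/-! ### Linear quotients and linear resolutions -/

section Resolution

/-- A list of module elements has linear quotients if the colon ideal of each entry with respect to
the submodule generated by the entries after it is generated by linear forms. -/
def HasLinearQuotients {K R M : Type*} [Field K] [CommRing R] [Algebra K R] [AddCommGroup M]
    [Module R M] (L : Submodule K R) : List M → Prop
  | [] => True
  | v :: l => HasLinearQuotients L l ∧
      ∃ s : Set R, s ⊆ L ∧ ∀ f : R, f • v ∈ Submodule.span R {x | x ∈ l} ↔ f ∈ Ideal.span s

/-- The module of relations between the entries of a list. -/
noncomputable def syzygies {R M : Type*} [CommRing R] [AddCommGroup M] [Module R M] (l : List M) :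
    Submodule R (Fin l.length → R) :=
  LinearMap.ker (Fintype.linearCombination R l.get)

variable {K R M N : Type*} [Field K] [CommRing R] [Algebra K R] [AddCommGroup M] [Module R M]
  [AddCommGroup N] [Module R N] {L : Submodule K R}

theorem span_mem_list_map (g : M →ₗ[R] N) (l : List M) :
    Submodule.span R {x | x ∈ l.map g} = (Submodule.span R {x | x ∈ l}).map g := by
  rw [Submodule.map_span]
  congr 1
  ext x
  simp

theorem HasLinearQuotients.map {l : List M} (h : HasLinearQuotients L l) {g : M →ₗ[R] N}
    (hg : Function.Injective g) : HasLinearQuotients L (l.map g) := by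
  induction l with
  | nil => trivial
  | cons v l ih =>
    obtain ⟨h1, s, hs, h2⟩ := h
    refine ⟨ih h1, s, hs, fun f => ?_⟩
    rw [← h2, span_mem_list_map, ← map_smul, Submodule.mem_map]
    exact ⟨fun ⟨y, hy, hyf⟩ => hg hyf ▸ hy, fun hy => ⟨_, hy, rfl⟩⟩

theorem setOf_mem_cons {α : Type*} (v : α) (l : List α) : {x | x ∈ v :: l} = insert v {x | x ∈ l} := by
  ext x
  simp

/-- An ideal generated by linear forms has a generating list of linear forms with linear
quotients. -/
theorem HasLinearColons.exists_list [IsNoetherianRing R] (h : HasLinearColons L) {s : Set R}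
    (hs : s ⊆ L) : ∃ l : List R, (∀ x ∈ l, x ∈ L) ∧ HasLinearQuotients L l ∧
      Ideal.span {x | x ∈ l} = Ideal.span s := by
  classical
  obtain ⟨t, hts, ht⟩ := Submodule.fg_span_iff_fg_span_finset_subset s |>.1
    (IsNoetherian.noetherian (Ideal.span s))
  have key : ∀ t : Finset R, (t : Set R) ⊆ L → ∃ l : List R, (∀ x ∈ l, x ∈ L) ∧
      HasLinearQuotients L l ∧ Ideal.span {x | x ∈ l} = Ideal.span (t : Set R) := by
    intro t
    induction t using Finset.induction_on with
    | empty => exact fun _ => ⟨[], by simp, trivial, by simp⟩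
    | insert a t _ ih =>
      intro hat
      rw [Finset.coe_insert, Set.insert_subset_iff] at hat
      obtain ⟨l, hl, hq, hspan⟩ := ih hat.2
      by_cases ha : a ∈ Ideal.span (t : Set R)
      -- A redundant generator must be dropped: its colon ideal is the whole ring.
      · refine ⟨l, hl, hq, ?_⟩
        rw [hspan, Finset.coe_insert]
        exact (Submodule.span_insert_eq_span ha).symm
      · refine ⟨a :: l, by simpa using ⟨hat.1, hl⟩, ⟨hq, _, fun g hg => hg.1, fun f =>
          ⟨fun hf => h {x | x ∈ l} hl a hat.1 (by rwa [hspan]) f hf, fun hf => ?_⟩⟩, ?_⟩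
        · have hle : Ideal.span {g | g ∈ L ∧ g * a ∈ Ideal.span {x | x ∈ l}} ≤
              (Submodule.span R {x | x ∈ l}).comap (LinearMap.toSpanSingleton R R a) := by
            rw [Ideal.span_le]
            exact fun g hg => hg.2
          exact hle hf
        · rw [setOf_mem_cons, Finset.coe_insert, Ideal.span_insert, Ideal.span_insert, hspan]
  obtain ⟨l, h1, h2, h3⟩ := key t (hts.trans hs)
  exact ⟨l, h1, h2, h3.trans ht.symm⟩

theorem mem_syzygies_cons {v : M} {l : List M} {x : Fin (l.length + 1) → R} :
    x ∈ syzygies (v :: l) ↔ x 0 • v + ∑ i : Fin l.length, x i.succ • l.get i = 0 := by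
  rw [syzygies, LinearMap.mem_ker, Fintype.linearCombination_apply]
  change ∑ i : Fin (l.length + 1), x i • (v :: l).get i = 0 ↔ _
  rw [Fin.sum_univ_succ]
  rfl

theorem mem_syzygies {l : List M} {x : Fin l.length → R} :
    x ∈ syzygies l ↔ ∑ i : Fin l.length, x i • l.get i = 0 := by
  rw [syzygies, LinearMap.mem_ker, Fintype.linearCombination_apply]

/-- Prepending a zero coordinate. -/
def consZero (R : Type*) [CommRing R] (n : ℕ) : (Fin n → R) →ₗ[R] (Fin (n + 1) → R) where
  toFun u := Fin.cons 0 u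
  map_add' u w := by
    ext i
    refine Fin.cases ?_ (fun i => ?_) i <;> simp
  map_smul' c u := by
    ext i
    refine Fin.cases ?_ (fun i => ?_) i <;> simp

@[simp]
theorem consZero_zero {n : ℕ} (u : Fin n → R) : consZero R n u 0 = 0 := rfl

@[simp]
theorem consZero_succ {n : ℕ} (u : Fin n → R) (i : Fin n) : consZero R n u i.succ = u i := rfl

theorem consZero_injective (n : ℕ) : Function.Injective (consZero R n) :=
  fun u w h => funext fun i => by simpa using congrFun h i.succ

/-- Membership of a syzygy in a module `P` of syzygies that contains those of the tail of the list can
be tested on first coordinates, since the syzygies of the tail are exactly those with vanishing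
first coordinate. -/
theorem mem_of_apply_zero_mem {v : M} {l : List M} {P : Submodule R (Fin (l.length + 1) → R)}
    (hP : P ≤ syzygies (v :: l)) (hP' : (syzygies l).map (consZero R l.length) ≤ P)
    {x : Fin (l.length + 1) → R} (hx : x ∈ syzygies (v :: l))
    (hx0 : x 0 ∈ P.map (LinearMap.proj 0)) : x ∈ P := by
  obtain ⟨y, hy, hyx⟩ := hx0
  have hyx' : y 0 = x 0 := hyx
  have hsub : x - y ∈ syzygies (v :: l) := Submodule.sub_mem _ hx (hP hy)
  have h2 : x - y ∈ P := by
    refine hP' ⟨fun i => (x - y) i.succ, ?_, ?_⟩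
    · have := mem_syzygies_cons.1 hsub
      rw [Pi.sub_apply, hyx', sub_self, zero_smul, zero_add] at this
      exact mem_syzygies.2 this
    · ext i
      refine Fin.cases ?_ (fun i => rfl) i
      simp [hyx']
  simpa using P.add_mem h2 hy

open Polynomial in
/-- If a linear multiple of a vector `v` of linear forms is a combination of vectors of linear
forms, the coefficients can be chosen linear: take their components of degree one. -/
theorem IsDegreeHom.exists_linear_coeff {φ : R →ₐ[K] R[X]} (hφ : IsDegreeHom L φ) {ι : Type*}
    {l : List (ι → R)} (hl : ∀ w ∈ l, ∀ i, w i ∈ L) {v : ι → R} (hv : ∀ i, v i ∈ L) {a : R}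
    (ha : a ∈ L) (hav : a • v ∈ Submodule.span R {x | x ∈ l}) :
    ∃ r : Fin l.length → R, (∀ i, r i ∈ L) ∧ ∑ i, r i • l.get i = a • v := by
  have hrange : {x | x ∈ l} = Set.range l.get := by
    ext x
    simp [List.mem_iff_get]
  rw [hrange, Submodule.mem_span_range_iff_exists_fun] at hav
  obtain ⟨c, hc⟩ := hav
  refine ⟨fun i => (φ (c i)).coeff 1, fun i => hφ.coeff_one _, ?_⟩
  ext j
  have hj := congrArg (fun y => (φ (y j)).coeff 2) hc
  simp only [Finset.sum_apply, Pi.smul_apply, smul_eq_mul, map_sum, finsetSum_coeff] at hj ⊢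
  rw [hφ.coeff_succ_mul (hv j), hφ.coeff_one_of_mem ha] at hj
  rw [← hj]
  refine Finset.sum_congr rfl fun i _ => ?_
  rw [hφ.coeff_succ_mul (hl _ (List.get_mem l i) j)]

/-- The syzygies of a list of vectors of linear forms with linear quotients are again generated
by such a list: its entries are those for the tail of the list, together with linear lifts of
generators of the colon ideal of the first entry. -/
theorem HasLinearColons.exists_syzygies_list [IsNoetherianRing R] (h : HasLinearColons L)
    {φ : R →ₐ[K] Polynomial R} (hφ : IsDegreeHom L φ) {ι : Type*} (l : List (ι → R))
    (hq : HasLinearQuotients L l) (hl : ∀ w ∈ l, ∀ i, w i ∈ L) :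
    ∃ l' : List (Fin l.length → R), HasLinearQuotients L l' ∧ (∀ w ∈ l', ∀ i, w i ∈ L) ∧
      Submodule.span R {x | x ∈ l'} = syzygies l := by
  induction l with
  | nil =>
    refine ⟨[], trivial, by simp, ?_⟩
    have : Subsingleton (Fin ([] : List (ι → R)).length → R) :=
      inferInstanceAs (Subsingleton (Fin 0 → R))
    exact Subsingleton.elim _ _
  | cons v l ih =>
    obtain ⟨hq, s, hs, hcolon⟩ := hq
    obtain ⟨l', hq', hl', hspan⟩ := ih hq fun w hw => hl w (List.mem_cons_of_mem _ hw)
    obtain ⟨t, htL, htq, htspan⟩ := h.exists_list hs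
    have hbase : (syzygies l).map (consZero R l.length) ≤ syzygies (v :: l) := by
      rintro _ ⟨u, hu, rfl⟩
      refine mem_syzygies_cons.2 ?_
      simpa using mem_syzygies.1 hu
    have lift : ∀ t : List R, (∀ a ∈ t, a ∈ L) → (∀ a ∈ t, a • v ∈ Submodule.span R {x | x ∈ l}) →
        HasLinearQuotients L t → ∃ z : List (Fin (l.length + 1) → R),
          (∀ w ∈ z, ∀ i, w i ∈ L) ∧ HasLinearQuotients L z ∧
          Submodule.span R {x | x ∈ z} ≤ syzygies (v :: l) ∧
          (syzygies l).map (consZero R l.length) ≤ Submodule.span R {x | x ∈ z} ∧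
          (Submodule.span R {x | x ∈ z}).map (LinearMap.proj 0) = Ideal.span {x | x ∈ t} := by
      intro t
      induction t with
      | nil =>
        intro _ _ _
        refine ⟨l'.map (consZero R l.length), ?_, hq'.map (consZero_injective _), ?_, ?_, ?_⟩
        · intro w hw i
          obtain ⟨u, hu, rfl⟩ := List.mem_map.1 hw
          refine Fin.cases ?_ (fun i => ?_) i
          · exact L.zero_mem
          · exact hl' u hu i
        · rwa [span_mem_list_map, hspan]
        · rw [span_mem_list_map, hspan]
        · rw [span_mem_list_map, ← Submodule.map_comp]
          have : (LinearMap.proj 0 ∘ₗ consZero R l.length : (Fin l.length → R) →ₗ[R] R) = 0 := by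
            ext; simp
          simp [this]
      | cons a t iht =>
        intro haL hav hat
        obtain ⟨z, hzL, hzq, hzsyz, hzbase, hzproj⟩ := iht
          (fun b hb => haL b (List.mem_cons_of_mem _ hb))
          (fun b hb => hav b (List.mem_cons_of_mem _ hb)) hat.1
        obtain ⟨r, hrL, hr⟩ := hφ.exists_linear_coeff
          (fun w hw => hl w (List.mem_cons_of_mem _ hw)) (hl v List.mem_cons_self)
          (haL a List.mem_cons_self) (hav a List.mem_cons_self)
        let y : Fin (l.length + 1) → R := Fin.cons a (-r)
        have hy0 : y 0 = a := rfl
        have hysyz : y ∈ syzygies (v :: l) := by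
          refine mem_syzygies_cons.2 ?_
          rw [hy0, ← hr, ← Finset.sum_add_distrib]
          refine Finset.sum_eq_zero fun i _ => ?_
          rw [show y i.succ = -r i from rfl, neg_smul, add_neg_cancel]
        obtain ⟨s', hs', hcolon'⟩ := hat.2
        refine ⟨y :: z, ?_, ⟨hzq, s', hs', fun f => ?_⟩, ?_, ?_, ?_⟩
        · intro w hw i
          rcases List.mem_cons.1 hw with rfl | hw
          · refine Fin.cases ?_ (fun i => ?_) i
            · exact haL a List.mem_cons_self
            · exact L.neg_mem (hrL i)
          · exact hzL w hw i
        · rw [← hcolon']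
          constructor
          · intro hf
            have := Submodule.mem_map_of_mem (f := LinearMap.proj (R := R)
              (φ := fun _ : Fin (l.length + 1) => R) 0) hf
            rw [hzproj] at this
            exact this
          · intro hf
            refine mem_of_apply_zero_mem hzsyz hzbase (Submodule.smul_mem _ f hysyz) ?_
            rw [hzproj]
            exact hf
        · rw [setOf_mem_cons, Submodule.span_insert, sup_le_iff, Submodule.span_singleton_le_iff_mem]
          exact ⟨hysyz, hzsyz⟩
        · rw [setOf_mem_cons, Submodule.span_insert]
          exact hzbase.trans le_sup_right
        · rw [setOf_mem_cons, setOf_mem_cons, Submodule.span_insert, Ideal.span_insert,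
            Submodule.map_sup, hzproj, Submodule.map_span, Set.image_singleton]
          rfl
    have hts : ∀ a ∈ t, a • v ∈ Submodule.span R {x | x ∈ l} := by
      intro a ha
      rw [hcolon, ← htspan]
      exact Ideal.subset_span ha
    obtain ⟨z, hzL, hzq, hzsyz, hzbase, hzproj⟩ := lift t htL hts htq
    refine ⟨z, hzq, hzL, le_antisymm hzsyz fun x hx => ?_⟩
    refine mem_of_apply_zero_mem hzsyz hzbase hx ?_
    rw [hzproj, htspan, ← hcolon]
    have := mem_syzygies_cons.1 hx
    rw [eq_neg_of_add_eq_zero_left this]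
    refine Submodule.neg_mem _ (Submodule.sum_mem _ fun i _ => Submodule.smul_mem _ _ ?_)
    exact Submodule.subset_span (List.get_mem l i)

/-- The matrix whose columns are the entries of a list. -/
def columnMatrix {n : ℕ} (l : List (Fin n → R)) : Matrix (Fin n) (Fin l.length) R :=
  Matrix.of fun j k => l.get k j

theorem range_columnMatrix {n : ℕ} (l : List (Fin n → R)) :
    LinearMap.range (columnMatrix l).mulVecLin = Submodule.span R {x | x ∈ l} := by
  rw [Matrix.range_mulVecLin]
  congr 1
  ext x
  simp only [Set.mem_range, Set.mem_ofPred_eq, List.mem_iff_get]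
  rfl

theorem ker_columnMatrix {n : ℕ} (l : List (Fin n → R)) :
    LinearMap.ker (columnMatrix l).mulVecLin = syzygies l := by
  ext x
  rw [mem_syzygies, LinearMap.mem_ker, Matrix.mulVecLin_apply]
  have : (columnMatrix l).mulVec x = ∑ i, x i • l.get i := by
    ext j
    simp [columnMatrix, Matrix.mulVec, dotProduct, mul_comm]
  rw [this]

/-- If all colon ideals of linear forms are linear, quotients by ideals of linear forms have
linear resolutions, obtained by iterating `HasLinearColons.exists_syzygies_list`. -/
theorem HasLinearColons.hasLinearFreeResolution [IsNoetherianRing R] (h : HasLinearColons L)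
    {φ : R →ₐ[K] Polynomial R} (hφ : IsDegreeHom L φ) {𝒜 : ℕ → Submodule K R} (h0 : 1 ∈ 𝒜 0)
    (h1 : 𝒜 1 = L) {s : Set R} (hs : s ⊆ L) :
    HasLinearFreeResolution 𝒜 (quotientGrading 𝒜 (Ideal.span s)) := by
  let State : Type _ := Σ n : ℕ, {l : List (Fin n → R) //
    HasLinearQuotients L l ∧ ∀ w ∈ l, ∀ i, w i ∈ L}
  choose nl hnq hnL hnspan using fun S : State =>
    h.exists_syzygies_list hφ S.2.1 S.2.2.1 S.2.2.2
  let next : State → State := fun S => ⟨S.2.1.length, nl S, hnq S, hnL S⟩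
  obtain ⟨t, htL, htq, htspan⟩ := h.exists_list hs
  let e : R →ₗ[R] (Fin 1 → R) := LinearMap.pi fun _ => LinearMap.id
  have he : Function.Injective e := fun a b hab => congrFun hab 0
  let S0 : State := ⟨1, t.map e, htq.map he, fun w hw i => by
    obtain ⟨a, ha, rfl⟩ := List.mem_map.1 hw
    exact htL a ha⟩
  let S : ℕ → State := fun i => Nat.rec S0 (fun _ T => next T) i
  let ε : (Fin 1 → R) →ₗ[R] R ⧸ Ideal.span s :=
    (Submodule.mkQ (Ideal.span s)).comp (LinearMap.proj 0)
  refine ⟨fun i => (S i).1, fun i => columnMatrix (S i).2.1, ε, ?_, ⟨0, fun j => ?_⟩, ?_, ?_, ?_⟩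
  · intro i j k
    rw [h1]
    exact (S i).2.2.2 _ (List.get_mem (S i).2.1 k) j
  · have hj : j = (0 : Fin 1) := Subsingleton.elim (α := Fin 1) _ _
    subst hj
    exact ⟨1, h0, rfl⟩
  · intro y
    obtain ⟨r, rfl⟩ := Submodule.mkQ_surjective _ y
    exact ⟨fun _ => r, rfl⟩
  · change LinearMap.ker ε = LinearMap.range (columnMatrix (t.map e)).mulVecLin
    rw [range_columnMatrix, span_mem_list_map]
    ext x
    have hx : x ∈ LinearMap.ker ε ↔ x 0 ∈ Ideal.span s := by
      rw [LinearMap.mem_ker]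
      exact Submodule.Quotient.mk_eq_zero _
    rw [hx, ← htspan]
    constructor
    · intro hx0
      refine ⟨x 0, hx0, ?_⟩
      ext i
      rw [Subsingleton.elim i 0]
      rfl
    · rintro ⟨a, ha, rfl⟩
      exact ha
  · intro i
    rw [ker_columnMatrix, range_columnMatrix]
    exact (hnspan (S i)).symm

end Resolution

/-! ### Obstruction from incomparable neighbourhoods -/

section Obstruction

variable {K : Type*} [Field K] {V : Type*} {G : SimpleGraph V}

open Classical in
/-- For a set `U` of pairwise nonadjacent vertices, the homomorphism to the polynomial ring that
sets the variables outside `U` to zero. -/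
noncomputable def edgeToPolynomial (K : Type*) [Field K] {V : Type*} {G : SimpleGraph V}
    {U : Set V} (hU : G.IsIndepSet U) : EdgeRing K G →ₐ[K] MvPolynomial V K :=
  edgeLift (fun v => if v ∈ U then MvPolynomial.X v else 0) (fun u v h => by
    by_cases hu : u ∈ U
    · by_cases hv : v ∈ U
      · exact absurd h (hU hu hv h.ne)
      · simp [hv]
    · simp [hu])

theorem edgeToPolynomial_of_mem {U : Set V} (hU : G.IsIndepSet U) {v : V} (h : v ∈ U) :
    edgeToPolynomial K hU (edgeVar K G v) = MvPolynomial.X v := by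
  simp [edgeToPolynomial, h]

theorem edgeToPolynomial_of_notMem {U : Set V} (hU : G.IsIndepSet U) {v : V} (h : v ∉ U) :
    edgeToPolynomial K hU (edgeVar K G v) = 0 := by
  simp [edgeToPolynomial, h]

theorem isIndepSet_pair {u v : V} (h : ¬ G.Adj u v) : G.IsIndepSet {u, v} := by
  intro a ha b hb hab
  rcases ha with rfl | rfl <;> rcases hb with rfl | rfl
  · exact absurd rfl hab
  · exact h
  · exact fun h' => h h'.symm
  · exact absurd rfl hab

/-- For `p ~ r`, `q ~ s` with `{r, q}`, `{p, s}`, `{r, s}` independent, any linear form annihilated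
by `X_p - X_q` involves neither `X_r` nor `X_s`. -/
theorem edgeToPolynomial_eq_zero_of_mul_eq_zero {p q r s : V} (hrq : ¬ G.Adj r q)
    (hps : ¬ G.Adj p s) (hrs : ¬ G.Adj r s) (hpr : p ≠ r) (hqs : q ≠ s) (hpq : p ≠ q)
    (hr : r ≠ s) {F : EdgeRing K G} (hF : F ∈ edgeLinearForms K G)
    (h : F * (edgeVar K G p - edgeVar K G q) = 0) :
    edgeToPolynomial K (isIndepSet_pair hrs) F = 0 := by
  classical
  let keep : V → MvPolynomial V K →ₐ[K] MvPolynomial V K := fun v =>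
    MvPolynomial.aeval fun w => if w = v then MvPolynomial.X v else 0
  have h1 : edgeToPolynomial K (isIndepSet_pair hps) F = 0 := by
    have := congrArg (edgeToPolynomial K (isIndepSet_pair hps)) h
    rw [map_mul, map_sub, map_zero, edgeToPolynomial_of_mem _ (by simp),
      edgeToPolynomial_of_notMem _ (by simp [hpq.symm, hqs]), sub_zero] at this
    exact (mul_eq_zero.1 this).resolve_right (MvPolynomial.X_ne_zero p)
  have h2 : edgeToPolynomial K (isIndepSet_pair hrq) F = 0 := by
    have := congrArg (edgeToPolynomial K (isIndepSet_pair hrq)) h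
    rw [map_mul, map_sub, map_zero, edgeToPolynomial_of_mem (v := q) _ (by simp),
      edgeToPolynomial_of_notMem _ (by simp [hpr, hpq]), zero_sub] at this
    exact (mul_eq_zero.1 this).resolve_right (neg_ne_zero.2 (MvPolynomial.X_ne_zero q))
  have h3 : ∀ F ∈ edgeLinearForms K G, edgeToPolynomial K (isIndepSet_pair hrs) F =
      keep r (edgeToPolynomial K (isIndepSet_pair hrq) F) +
        keep s (edgeToPolynomial K (isIndepSet_pair hps) F) := by
    intro F hF
    induction hF using Submodule.span_induction with
    | mem x hx =>
      obtain ⟨v, rfl⟩ := hx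
      by_cases hvr : v = r
      · subst hvr
        rw [edgeToPolynomial_of_mem _ (by simp), edgeToPolynomial_of_mem _ (by simp),
          edgeToPolynomial_of_notMem _ (by simp [hpr.symm, hr])]
        simp [keep]
      · by_cases hvs : v = s
        · subst hvs
          rw [edgeToPolynomial_of_mem (U := {r, v}) _ (by simp),
            edgeToPolynomial_of_mem (U := {p, v}) _ (by simp),
            edgeToPolynomial_of_notMem (U := {r, q}) _ (by simp [hr.symm, hqs.symm])]
          simp [keep]
        · rw [edgeToPolynomial_of_notMem _ (by simp [hvr, hvs])]
          by_cases hvp : v = p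
          · subst hvp
            rw [edgeToPolynomial_of_mem (U := {v, s}) _ (by simp),
              edgeToPolynomial_of_notMem (U := {r, q}) _ (by simp [hvr, hpq])]
            simp [keep, hvs]
          · rw [edgeToPolynomial_of_notMem (U := {p, s}) _ (by simp [hvp, hvs])]
            by_cases hvq : v = q
            · subst hvq
              rw [edgeToPolynomial_of_mem _ (by simp)]
              simp [keep, hvr]
            · rw [edgeToPolynomial_of_notMem _ (by simp [hvr, hvq])]
              simp
    | zero => simp
    | add x y _ _ hx hy =>
      simp only [map_add, hx, hy]
      ring
    | smul c x _ hx => simp only [map_smul, hx, smul_add]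
  rw [h3 F hF, h1, h2, map_zero, map_zero, add_zero]

open Polynomial in
/-- The degree-zero part of an element of the ideal of linear forms vanishes. -/
theorem IsDegreeHom.coeff_zero_eq_zero {R : Type*} [CommRing R] [Algebra K R] {L : Submodule K R}
    {φ : R →ₐ[K] R[X]} (hφ : IsDegreeHom L φ) {f : R} (hf : f ∈ Ideal.span (L : Set R)) :
    (φ f).coeff 0 = 0 := by
  induction hf using Submodule.closure_induction with
  | zero => simp
  | add x y _ _ hx hy => simp [hx, hy]
  | smul_mem r x hx =>
    rw [smul_eq_mul, map_mul, hφ.map_linear x hx, ← mul_assoc, coeff_mul_X_zero]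

/-- If `R / (ℓ)` has a linear resolution, then the annihilator of `ℓ` is generated by linear
forms: the first two steps of the resolution are, up to units and redundant generators, `R → R / (ℓ)`
and multiplication by `ℓ`. -/
theorem IsDegreeHom.mem_span_of_mul_eq_zero {R : Type*} [CommRing R] [Nontrivial R] [Algebra K R]
    {L : Submodule K R} {φ : R →ₐ[K] Polynomial R} (hφ : IsDegreeHom L φ)
    {𝒜 : ℕ → Submodule K R} (h0 : ∀ a ∈ 𝒜 0, ∃ c : K, a = algebraMap K R c) (h1 : 𝒜 1 = L)
    (hpos : ∀ d ≠ 0, ∀ a ∈ 𝒜 d, a ∈ Ideal.span (L : Set R)) {ℓ : R} (hℓ : ℓ ∈ L) (hℓ0 : ℓ ≠ 0)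
    (hres : HasLinearFreeResolution 𝒜 (quotientGrading 𝒜 (Ideal.span {ℓ}))) {y : R}
    (hy : y * ℓ = 0) : y ∈ Ideal.span {F | F ∈ L ∧ F * ℓ = 0} := by
  classical
  set J : Ideal R := Ideal.span {ℓ} with hJ
  obtain ⟨b, A, ε, hlin, ⟨d, hd⟩, hsurj, hex0, hex⟩ := hres
  set m : Ideal R := Ideal.span (L : Set R) with hm
  have hJm : J ≤ m := by
    rw [hJ, Ideal.span_singleton_le_iff_mem]
    exact Ideal.subset_span hℓ
  have hone : (1 : R) ∉ m := fun h => by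
    have := hφ.coeff_zero_eq_zero h
    simp at this
  have hentry : ∀ i j k, A i j k ∈ L := fun i j k => h1 ▸ hlin i j k
  choose a ha haε using hd
  -- The augmentation lifts to the map `R ^ b 0 → R` with coefficients `a`.
  have hε : ∀ u, ε u = Ideal.Quotient.mk J (∑ j, u j * a j) := by
    intro u
    have : ε = (Submodule.mkQ J).comp (Fintype.linearCombination R a) := by
      refine LinearMap.pi_ext' fun j => LinearMap.ext_ring ?_
      have hj : ε (Pi.single j 1) = Submodule.mkQ J (a j) := (haε j).symm
      simpa [Fintype.linearCombination_apply_single] using hj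
    rw [this]
    rfl
  have hker : ∀ u, u ∈ LinearMap.ker ε ↔ ∑ j, u j * a j ∈ J := by
    intro u
    rw [LinearMap.mem_ker, hε, Ideal.Quotient.eq_zero_iff_mem]
  obtain ⟨u, hu⟩ := hsurj (Ideal.Quotient.mk J 1)
  rw [hε, Ideal.Quotient.eq] at hu
  have hum : ∑ j, u j * a j ∉ m := fun h => hone (by
    have := m.sub_mem h (hJm hu)
    rwa [sub_sub_cancel] at this)
  have hd0 : d = 0 := by
    by_contra hd0
    exact hum (Ideal.sum_mem _ fun j _ => Ideal.mul_mem_left _ _ (hpos d hd0 _ (ha j)))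
  subst hd0
  choose c hc using fun j => h0 (a j) (ha j)
  obtain ⟨j0, hj0⟩ : ∃ j, c j ≠ 0 := by
    by_contra! hcon
    exact hum (Ideal.sum_mem _ fun j _ => by simp [hc, hcon])
  have hinv : ∀ {x : K}, x ≠ 0 → algebraMap K R x⁻¹ * algebraMap K R x = 1 := fun hx => by
    rw [← map_mul, inv_mul_cancel₀ hx, map_one]
  -- Relations have entries in the maximal ideal, so there is only one generator.
  have hsub : ∀ j, j = j0 := by
    intro j
    by_contra hj
    set w : Fin (b 0) → R :=
      Pi.single j 1 - Pi.single j0 (algebraMap K R (c j) * algebraMap K R (c j0)⁻¹) with hw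
    have hwker : w ∈ LinearMap.ker ε := by
      rw [hker]
      have : ∑ i, w i * a i = 0 := by
        simp only [hw, Pi.sub_apply, sub_mul, Finset.sum_sub_distrib, Pi.single_apply, ite_mul,
          zero_mul, Finset.sum_ite_eq', Finset.mem_univ, if_true, hc]
        rw [mul_assoc, hinv hj0]
        ring
      rw [this]
      exact J.zero_mem
    rw [hex0] at hwker
    obtain ⟨g, hg⟩ := hwker
    have hwj : w j = 1 := by simp [hw, hj]
    apply hone
    rw [← hwj, ← hg, Matrix.mulVecLin_apply, Matrix.mulVec, dotProduct]
    exact Ideal.sum_mem _ fun k _ => Ideal.mul_mem_right _ _ (Ideal.subset_span (hentry 0 j k))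
  have hker' : ∀ u, u ∈ LinearMap.ker ε ↔ u j0 ∈ J := by
    intro u
    rw [hker, Finset.sum_eq_single j0 (fun j _ hj => absurd (hsub j) hj) (by simp), hc]
    constructor
    · intro h
      have := J.mul_mem_right (algebraMap K R (c j0)⁻¹) h
      rwa [mul_assoc, mul_comm (algebraMap K R (c j0)), hinv hj0, mul_one] at this
    · exact fun h => J.mul_mem_right _ h
  -- The linear entries of the first matrix lie in `(ℓ)`, hence are scalar multiples of `ℓ`.
  have hA0 : ∀ k, ∃ t : K, A 0 j0 k = algebraMap K R t * ℓ := by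
    intro k
    have hk : (A 0).mulVecLin (Pi.single k 1) ∈ LinearMap.ker ε := hex0 ▸ ⟨_, rfl⟩
    rw [hker', Matrix.mulVecLin_apply, Matrix.mulVec_single_one, hJ,
      Ideal.mem_span_singleton'] at hk
    obtain ⟨h, hh⟩ := hk
    obtain ⟨t, ht⟩ := hφ.coeff_zero h
    refine ⟨t, ?_⟩
    have hcoeff := congrArg (fun z => (φ z).coeff 1) hh
    simp only [hφ.coeff_succ_mul hℓ, Matrix.col_apply, hφ.coeff_one_of_mem (hentry 0 j0 k),
      ht] at hcoeff
    exact hcoeff.symm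
  choose t ht using hA0
  obtain ⟨k0, hk0⟩ : ∃ k, t k ≠ 0 := by
    by_contra! hcon
    have hℓker : (Pi.single j0 ℓ : Fin (b 0) → R) ∈ LinearMap.ker ε := by
      rw [hker', Pi.single_eq_same]
      exact Ideal.subset_span rfl
    rw [hex0] at hℓker
    obtain ⟨g, hg⟩ := hℓker
    have := congrFun hg j0
    rw [Pi.single_eq_same, Matrix.mulVecLin_apply, Matrix.mulVec, dotProduct] at this
    simp only [ht, hcon, map_zero, zero_mul, Finset.sum_const_zero] at this
    exact hℓ0 this.symm
  have hmul : ∀ g, (A 0).mulVecLin g = 0 ↔ (∑ k, algebraMap K R (t k) * g k) * ℓ = 0 := by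
    intro g
    have : (A 0).mulVecLin g j0 = (∑ k, algebraMap K R (t k) * g k) * ℓ := by
      rw [Matrix.mulVecLin_apply, Matrix.mulVec, dotProduct, Finset.sum_mul]
      refine Finset.sum_congr rfl fun k _ => ?_
      rw [ht]
      ring
    rw [← this]
    refine ⟨fun h => by rw [h]; rfl, fun h => funext fun j => ?_⟩
    rw [hsub j]
    exact h
  have hyker : (Pi.single k0 y : Fin (b 1) → R) ∈ LinearMap.ker (A 0).mulVecLin := by
    rw [LinearMap.mem_ker, hmul]
    simp [Pi.single_apply, mul_assoc, hy]
  rw [hex 0] at hyker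
  obtain ⟨h, hh⟩ := hyker
  set F : Fin (b 2) → R := fun j => ∑ k, algebraMap K R (t k) * A 1 k j with hF
  have hFmem : ∀ j, F j ∈ L ∧ F j * ℓ = 0 := by
    intro j
    constructor
    · refine Submodule.sum_mem _ fun k _ => ?_
      rw [← Algebra.smul_def]
      exact Submodule.smul_mem _ _ (hentry 1 k j)
    · have hj : (A 1).mulVecLin (Pi.single j 1) ∈ LinearMap.ker (A 0).mulVecLin := by
        rw [hex 0]
        exact ⟨_, rfl⟩
      rw [LinearMap.mem_ker, hmul] at hj
      simpa [Matrix.mulVec_single_one] using hj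
  have hty : algebraMap K R (t k0) * y = ∑ j, h j * F j := by
    have e1 : ∑ k, algebraMap K R (t k) * (Pi.single k0 y : Fin (b 1) → R) k =
        algebraMap K R (t k0) * y := by
      simp [Pi.single_apply]
    rw [← e1, ← hh]
    simp only [Matrix.mulVecLin_apply, Matrix.mulVec, dotProduct, hF, Finset.mul_sum]
    rw [Finset.sum_comm]
    refine Finset.sum_congr rfl fun j _ => Finset.sum_congr rfl fun k _ => ?_
    ring
  have hyeq : y = algebraMap K R (t k0)⁻¹ * ∑ j, h j * F j := by
    rw [← hty, ← mul_assoc, hinv hk0, one_mul]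
  rw [hyeq]
  exact Ideal.mul_mem_left _ _ (Ideal.sum_mem _ fun j _ =>
    Ideal.mul_mem_left _ _ (Ideal.subset_span (hFmem j)))

theorem edgeDegreeHom_coeff_zero (p : MvPolynomial V K) :
    (edgeDegreeHom K G (Ideal.Quotient.mk _ p)).coeff 0 =
      algebraMap K (EdgeRing K G) (MvPolynomial.constantCoeff p) := by
  induction p using MvPolynomial.induction_on with
  | C c =>
    rw [MvPolynomial.constantCoeff_C]
    have : edgeDegreeHom K G (algebraMap K (EdgeRing K G) c) = _ := AlgHom.commutes _ c
    rw [Polynomial.algebraMap_apply] at this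
    exact (congrArg (fun q => q.coeff 0) this).trans Polynomial.coeff_C_zero
  | add p q hp hq => rw [map_add, map_add, Polynomial.coeff_add, hp, hq, map_add, map_add]
  | mul_X p v hp =>
    have : edgeDegreeHom K G (Ideal.Quotient.mk _ (MvPolynomial.X v)) =
        Polynomial.C (edgeVar K G v) * Polynomial.X := edgeLift_edgeVar _ _ v
    rw [map_mul, map_mul, this, ← mul_assoc, Polynomial.coeff_mul_X_zero, map_mul,
      MvPolynomial.constantCoeff_X, mul_zero, map_zero]

theorem exists_algebraMap_of_mem_edgeRingGrading_zero {a : EdgeRing K G}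
    (ha : a ∈ edgeRingGrading K G 0) : ∃ c : K, a = algebraMap K _ c := by
  obtain ⟨p, hp, rfl⟩ := ha
  rw [SetLike.mem_coe, MvPolynomial.homogeneousSubmodule_zero, Submodule.mem_one] at hp
  obtain ⟨c, rfl⟩ := hp
  exact ⟨c, rfl⟩

theorem mem_span_of_mem_edgeRingGrading {d : ℕ} (hd : d ≠ 0) {a : EdgeRing K G}
    (ha : a ∈ edgeRingGrading K G d) :
    a ∈ Ideal.span (edgeLinearForms K G : Set (EdgeRing K G)) := by
  obtain ⟨p, hp, rfl⟩ := ha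
  have hp0 : MvPolynomial.constantCoeff p = 0 := by
    rw [SetLike.mem_coe, MvPolynomial.mem_homogeneousSubmodule] at hp
    exact hp.coeff_eq_zero (by simpa using hd.symm)
  have h := (isDegreeHom_edgeDegreeHom (K := K) (G := G)).sub_coeff_zero_mem (Ideal.Quotient.mk _ p)
  rw [edgeDegreeHom_coeff_zero, hp0, map_zero, sub_zero] at h
  exact h

/-- For `p ~ r` and `q ~ s` separating the nonadjacent vertices `r` and `s`, the annihilator of
`X_p - X_q` contains `X_r X_s`, but no linear form in it involves `X_r` or `X_s`. -/
theorem IsUniversallyKoszul.hasNestedNeighbors (h : IsUniversallyKoszul (edgeRingGrading K G)) :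
    HasNestedNeighbors G := by
  intro r s hrs
  by_contra! hcon
  obtain ⟨⟨p, hp, hp'⟩, ⟨q, hq, hq'⟩⟩ :=
    And.intro (Set.not_subset.1 hcon.1) (Set.not_subset.1 hcon.2)
  simp only [SimpleGraph.mem_neighborSet] at hp hp' hq hq'
  have hps : ¬ G.Adj p s := fun h => hp' h.symm
  have hrs' : r ≠ s := by rintro rfl; exact hp' hp
  have hpq : p ≠ q := by rintro rfl; exact hp' hq
  have hnt : Nontrivial (EdgeRing K G) :=
    (edgeToPolynomial K (isIndepSet_pair hrs)).toRingHom.domain_nontrivial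
  have hℓ : edgeVar K G p - edgeVar K G q ∈ edgeLinearForms K G :=
    Submodule.sub_mem _ (edgeVar_mem p) (edgeVar_mem q)
  have hℓ0 : edgeVar K G p - edgeVar K G q ≠ 0 := by
    intro h0
    have := congrArg (edgeToPolynomial K (isIndepSet_pair hps)) h0
    rw [map_sub, map_zero, edgeToPolynomial_of_mem _ (by simp),
      edgeToPolynomial_of_notMem _ (by simp [hpq.symm, hq.ne']), sub_zero] at this
    exact MvPolynomial.X_ne_zero p this
  have hy : edgeVar K G r * edgeVar K G s * (edgeVar K G p - edgeVar K G q) = 0 := by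
    have e1 := edgeVar_mul_edgeVar (K := K) hp
    have e2 := edgeVar_mul_edgeVar (K := K) hq
    linear_combination edgeVar K G s * e1 - edgeVar K G r * e2
  have hmem := isDegreeHom_edgeDegreeHom.mem_span_of_mul_eq_zero
    (fun _ => exists_algebraMap_of_mem_edgeRingGrading_zero) edgeRingGrading_one
    (fun _ hd _ => mem_span_of_mem_edgeRingGrading hd) hℓ hℓ0
    (h _ (by simpa [edgeRingGrading_one] using hℓ)) hy
  have hle : Ideal.span {F | F ∈ edgeLinearForms K G ∧
      F * (edgeVar K G p - edgeVar K G q) = 0} ≤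
      RingHom.ker (edgeToPolynomial K (isIndepSet_pair hrs)) := by
    rw [Ideal.span_le]
    exact fun F hF => edgeToPolynomial_eq_zero_of_mul_eq_zero hq' hps hrs hp.ne' hq.ne' hpq hrs'
      hF.1 hF.2
  have := hle hmem
  rw [RingHom.mem_ker, map_mul, edgeToPolynomial_of_mem _ (by simp),
    edgeToPolynomial_of_mem _ (by simp)] at this
  exact mul_ne_zero (MvPolynomial.X_ne_zero r) (MvPolynomial.X_ne_zero s) this

end Obstruction

/-! ### Universally Koszul edge rings -/

theorem mainTheorem1 {K : Type*} [Field K] {V : Type*} [Finite V] (G : SimpleGraph V) :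
    IsUniversallyKoszul (edgeRingGrading K G) ↔ IsTwoK2P4Free G := by
  rw [isTwoK2P4Free_iff_hasNestedNeighbors]
  refine ⟨fun h => h.hasNestedNeighbors, fun h s hs => ?_⟩
  exact h.hasLinearColons.hasLinearFreeResolution (𝒜 := edgeRingGrading K G)
    isDegreeHom_edgeDegreeHom ⟨1, MvPolynomial.isHomogeneous_one V K, rfl⟩ edgeRingGrading_one
    fun x hx => edgeRingGrading_one (K := K) (G := G) ▸ hs x hx
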